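/- Let $\mathbb{F}$ be $\mathbb{R}$ or $\mathbb{C}$. For a tensor $x\in\mathbb{F}^m\otimes\mathbb{F}^n\otimes\mathbb{F}^p$, the rank of $x$ is the least integer $r\ge 0$ such that $$x=\sum_{i=1}^r a_i\otimes b_i\otimes c_i$$ for some $a_i\in\mathbb{F}^m$, $b_i\in\mathbb{F}^n$, $c_i\in\mathbb{F}^p$ ($i=1,\dots,r$). Let $\mathrm{max.rank}_{\mathbb{F}}(m,n,p)$ denote the maximum of the ranks of all tensors in $\mathbb{F}^m\otimes\mathbb{F}^n\otimes\mathbb{F}^p$. Then: 1. $\mathrm{max.rank}_{\mathbb{F}}(3,3,3)\le 5$ for $\mathbb{F}=\mathbb{R}$ and for $\mathbb{F}=\mathbb{C}$; 2. $\mathrm{max.rank}_{\mathbb{C}}(4,4,3)\le 7$; 3. $\mathrm{max.rank}_{\mathbb{F}}(5,5,3)\le 9$ for $\mathbb{F}=\mathbb{R}$ and for $\mathbb{F}=\mathbb{C}$; 4. $\mathrm{max.rank}_{\mathbb{C}}(6,6,3)\le 11$. -/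

import Mathlib

open scoped TensorProduct

/-- The space `𝔽^m ⊗ 𝔽^n ⊗ 𝔽^p` of tensors of size `m × n × p` over `𝔽`. -/
abbrev Tensor3 (𝔽 : Type*) [Field 𝔽] (m n p : ℕ) : Type _ :=
  (Fin m → 𝔽) ⊗[𝔽] (Fin n → 𝔽) ⊗[𝔽] (Fin p → 𝔽)

/-- `x` is a sum of `r` tensors of the form `a ⊗ b ⊗ c`. -/
def IsSumOfPure {𝔽 : Type*} [Field 𝔽] {m n p : ℕ} (x : Tensor3 𝔽 m n p) (r : ℕ) : Prop :=
  ∃ (a : Fin r → Fin m → 𝔽) (b : Fin r → Fin n → 𝔽) (c : Fin r → Fin p → 𝔽),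
    x = ∑ i, (a i ⊗ₜ[𝔽] b i) ⊗ₜ[𝔽] c i

/-- The rank of a tensor: the least `r` such that `x` is a sum of `r` tensors `a ⊗ b ⊗ c`.
The infimum is taken in `ℕ∞`, where the infimum of the empty set is `⊤`. -/
noncomputable def tensorRank {𝔽 : Type*} [Field 𝔽] {m n p : ℕ} (x : Tensor3 𝔽 m n p) : ℕ∞ :=
  ⨅ (r : ℕ) (_ : IsSumOfPure x r), (r : ℕ∞)

/-- The maximal rank of the tensors of size `m × n × p` over `𝔽`.
The supremum is taken in `ℕ∞`, so it has no junk value. -/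
noncomputable def maxRank (𝔽 : Type*) [Field 𝔽] (m n p : ℕ) : ℕ∞ :=
  ⨆ x : Tensor3 𝔽 m n p, tensorRank x

/-! Each bound is the value `2 n - 1` for `n × n × 3` tensors, valid over `ℂ`, and over `ℝ` when `n`
is odd. Regard the tensor as three slices `(A, B, C)`. When `A` is invertible, an eigenvalue of `A⁻¹
B` in the field yields a singular combination of slices; it exists over `ℂ`, and over `ℝ` in odd
size. So `A` may be taken diagonal with entries `0` and `1`, and with a zero at some index `z`.

A triple of diagonal matrices vanishing at `z` costs `n - 1` pure tensors. It cancels `A` and leaves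
a pencil `(B + D, C + D')` with `D`, `D'` free away from `z`. A regular pencil whose determinant has
`n` distinct roots in the field costs `n` (`slicesRankLE_pencil`). With `D`, `D'` large, rescaling
turns the pencil into a small perturbation of one with explicit simple roots, and simple roots
persist in the field (`exists_slicesRankLE_perturb`). This settles the case where `B` or `C` has a
nonzero entry at a pair of kernel indices, and the case where the rows of `B`, `C` at `z` are
independent and their columns there are not both zero, or the transpose of this.

Otherwise all crosses through kernel indices are thin, and deleting such an index costs two pure
tensors. Over `ℂ` this is an induction on `n`. Over `ℝ` parity must be kept: two kernel indices are
deleted when `A` has corank at least two, and corank one is treated directly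
(`slicesRankLE_of_corank_one`). -/

open Matrix

/-- The `3`-tensor with slices `T 0`, `T 1`, `T 2` is a sum of `r` pure tensors. -/
def SlicesRankLE {F m n : Type*} [Field F] (T : Fin 3 → Matrix m n F) (r : ℕ) : Prop :=
  ∃ (a : Fin r → m → F) (b : Fin r → n → F) (c : Fin r → Fin 3 → F),
    ∀ k, T k = ∑ s, c s k • vecMulVec (a s) (b s)

/-! ### Invariance and additivity of the rank of slice triples -/

namespace SlicesRankLE

variable {F m n m' n' : Type*} [Field F] {T T' : Fin 3 → Matrix m n F} {r r' : ℕ}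

theorem of_fintype {σ : Type*} [Fintype σ] (a : σ → m → F) (b : σ → n → F) (c : σ → Fin 3 → F)
    (h : ∀ k, T k = ∑ s, c s k • vecMulVec (a s) (b s)) : SlicesRankLE T (Fintype.card σ) := by
  let e := (Fintype.equivFin σ).symm
  refine ⟨a ∘ e, b ∘ e, c ∘ e, fun k => ?_⟩
  rw [h k]
  exact (e.sum_comp fun s => c s k • vecMulVec (a s) (b s)).symm

theorem add (h : SlicesRankLE T r) (h' : SlicesRankLE T' r') :
    SlicesRankLE (fun k => T k + T' k) (r + r') := by
  obtain ⟨a, b, c, h⟩ := h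
  obtain ⟨a', b', c', h'⟩ := h'
  have := of_fintype (T := fun k => T k + T' k) (σ := Fin r ⊕ Fin r')
    (Sum.elim a a') (Sum.elim b b') (Sum.elim c c') (by simp [h, h'])
  simpa using this

theorem zero (r : ℕ) : SlicesRankLE (fun _ => 0 : Fin 3 → Matrix m n F) r :=
  ⟨0, 0, 0, by simp⟩

theorem mono (h : SlicesRankLE T r) (hr : r ≤ r') : SlicesRankLE T r' := by
  obtain ⟨s, rfl⟩ := Nat.exists_eq_add_of_le hr
  simpa using h.add (zero s)

theorem pure (a : m → F) (b : n → F) (c : Fin 3 → F) :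
    SlicesRankLE (fun k => c k • vecMulVec a b) 1 :=
  ⟨fun _ => a, fun _ => b, fun _ => c, by simp⟩

theorem mul_mul [Fintype m] [Fintype n] (h : SlicesRankLE T r) (U : Matrix m' m F)
    (V : Matrix n n' F) : SlicesRankLE (fun k => U * T k * V) r := by
  obtain ⟨a, b, c, h⟩ := h
  refine ⟨fun s => U *ᵥ a s, fun s => b s ᵥ* V, c, fun k => ?_⟩
  simp [h, Matrix.mul_sum, Matrix.sum_mul, mul_vecMulVec, vecMulVec_mul]

theorem of_mul_mul [Fintype m] [Fintype n] [DecidableEq m] [DecidableEq n] {U : Matrix m m F}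
    {V : Matrix n n F} (hU : IsUnit U.det) (hV : IsUnit V.det)
    (h : SlicesRankLE (fun k => U * T k * V) r) : SlicesRankLE T r := by
  have := h.mul_mul U⁻¹ V⁻¹
  convert this using 2 with k
  rw [Matrix.mul_assoc U, nonsing_inv_mul_cancel_left _ _ hU, mul_nonsing_inv_cancel_right _ _ hV]

theorem combine (h : SlicesRankLE T r) (g : Matrix (Fin 3) (Fin 3) F) :
    SlicesRankLE (fun k => ∑ j, g k j • T j) r := by
  obtain ⟨a, b, c, h⟩ := h
  refine ⟨a, b, fun s => g *ᵥ c s, fun k => ?_⟩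
  simp only [h, Finset.smul_sum, smul_smul, mulVec, dotProduct, Finset.sum_smul]
  exact Finset.sum_comm

theorem submatrix (h : SlicesRankLE T r) (e : m' → m) (f : n' → n) :
    SlicesRankLE (fun k => (T k).submatrix e f) r := by
  obtain ⟨a, b, c, h⟩ := h
  refine ⟨fun s => a s ∘ e, fun s => b s ∘ f, c, fun k => ?_⟩
  ext i j
  simp [h, Matrix.sum_apply, vecMulVec_apply]

theorem of_submatrix (e : m' ≃ m) (f : n' ≃ n)
    (h : SlicesRankLE (fun k => (T k).submatrix e f) r) : SlicesRankLE T r := by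
  simpa using h.submatrix e.symm f.symm

theorem transpose (h : SlicesRankLE T r) : SlicesRankLE (fun k => (T k)ᵀ) r := by
  obtain ⟨a, b, c, h⟩ := h
  refine ⟨b, a, c, fun k => ?_⟩
  ext i j
  simp [h, Matrix.sum_apply, vecMulVec_apply, mul_comm]

theorem of_transpose (h : SlicesRankLE (fun k => (T k)ᵀ) r) : SlicesRankLE T r := by
  simpa using h.transpose

theorem of_mul_diagonal_mul {σ : Type*} [Fintype σ] [DecidableEq σ] (W : Matrix m σ F)
    (V : Matrix σ n F) (d : Fin 3 → σ → F) (h : ∀ k, T k = W * diagonal (d k) * V) :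
    SlicesRankLE T (Fintype.card σ) := by
  refine of_fintype (fun s i => W i s) (fun s => V s) (fun s k => d k s) fun k => ?_
  ext i j
  rw [h, Matrix.mul_apply, Matrix.sum_apply]
  refine Finset.sum_congr rfl fun s _ => ?_
  simp [vecMulVec_apply]
  ring

/-- Extension of a tensor by a zero row and a zero column. -/
theorem fromBlocks_zero {κ : Type*} [Fintype m] [Fintype n] [DecidableEq m] [DecidableEq n]
    (h : SlicesRankLE T r) :
    SlicesRankLE (fun k => (fromBlocks (T k) 0 0 0 : Matrix (m ⊕ κ) (n ⊕ κ) F)) r := by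
  have := h.mul_mul (fromRows 1 0 : Matrix (m ⊕ κ) m F) (fromCols 1 0 : Matrix n (n ⊕ κ) F)
  convert this using 2 with k
  ext (i | i) (j | j) <;> simp [fromRows_mul, mul_fromCols]

theorem congr {A B C A' B' C' : Matrix m n F} (h : SlicesRankLE ![A', B', C'] r) (hA : A = A')
    (hB : B = B') (hC : C = C') : SlicesRankLE ![A, B, C] r := by
  rwa [hA, hB, hC]

theorem map_triple {X Y : Type*} (f : X → Y) (A B C : X) :
    (fun k : Fin 3 => f (![A, B, C] k)) = ![f A, f B, f C] := by
  funext k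
  fin_cases k <;> rfl

theorem eq_triple {X : Type*} (T : Fin 3 → X) : T = ![T 0, T 1, T 2] := by
  funext k
  fin_cases k <;> rfl

theorem add_triple {A B C A' B' C' : Matrix m n F} (h : SlicesRankLE ![A, B, C] r)
    (h' : SlicesRankLE ![A', B', C'] r') : SlicesRankLE ![A + A', B + B', C + C'] (r + r') := by
  rw [eq_triple ![A + A', B + B', C + C']]
  have := h.add h'
  rwa [eq_triple fun k => ![A, B, C] k + ![A', B', C'] k] at this

theorem of_mul_mul_triple [Fintype m] [Fintype n] [DecidableEq m] [DecidableEq n]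
    {U : Matrix m m F} {V : Matrix n n F} {A B C : Matrix m n F} (hU : IsUnit U.det)
    (hV : IsUnit V.det) (h : SlicesRankLE ![U * A * V, U * B * V, U * C * V] r) :
    SlicesRankLE ![A, B, C] r :=
  of_mul_mul hU hV (by rwa [map_triple fun M => U * M * V])

theorem of_submatrix_triple (e : m' ≃ m) (f : n' ≃ n) {A B C : Matrix m n F}
    (h : SlicesRankLE ![A.submatrix e f, B.submatrix e f, C.submatrix e f] r) :
    SlicesRankLE ![A, B, C] r :=
  of_submatrix e f (by rwa [map_triple fun M : Matrix m n F => M.submatrix e f])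

theorem of_transpose_triple {A B C : Matrix m n F} (h : SlicesRankLE ![Aᵀ, Bᵀ, Cᵀ] r) :
    SlicesRankLE ![A, B, C] r :=
  of_transpose (by rwa [map_triple fun M : Matrix m n F => Mᵀ])

theorem fromBlocks_zero_triple {κ : Type*} [Fintype m] [Fintype n] [DecidableEq m]
    [DecidableEq n] {A B C : Matrix m n F} (h : SlicesRankLE ![A, B, C] r) :
    SlicesRankLE ![fromBlocks A 0 0 0, fromBlocks B 0 0 0,
      (fromBlocks C 0 0 0 : Matrix (m ⊕ κ) (n ⊕ κ) F)] r := by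
  have := h.fromBlocks_zero (κ := κ)
  rwa [map_triple fun M => (fromBlocks M 0 0 0 : Matrix (m ⊕ κ) (n ⊕ κ) F)] at this

theorem pure_triple (a : m → F) (b : n → F) (x y z : F) :
    SlicesRankLE ![x • vecMulVec a b, y • vecMulVec a b, z • vecMulVec a b] 1 := by
  have := pure a b ![x, y, z]
  rwa [map_triple fun t => t • vecMulVec a b] at this

theorem swap_slices {A B C : Matrix m n F} (h : SlicesRankLE ![A, C, B] r) :
    SlicesRankLE ![A, B, C] r := by
  convert h.combine !![1, 0, 0; 0, 0, 1; 0, 1, 0] using 1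
  funext k
  fin_cases k <;> simp [Fin.sum_univ_three]

end SlicesRankLE

/-! ### Pencils with simple roots and their perturbations -/

section Pencil

variable {F n : Type*} [Fintype n] [DecidableEq n]

/-- With `Z = X + t • Y` invertible, a kernel vector of `X + ρ i • Y` is an eigenvector of `Z⁻¹ * Y`
for `(t - ρ i)⁻¹`. Distinct eigenvalues give an eigenbasis, in which `X` and `Y` become diagonal
simultaneously. -/
theorem slicesRankLE_pencil [Field F] (X Y : Matrix n n F) (ρ : n → F)
    (hρ : Function.Injective ρ) (h : ∀ i, (X + ρ i • Y).det = 0) (t : F)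
    (ht : (X + t • Y).det ≠ 0) : SlicesRankLE ![0, X, Y] (Fintype.card n) := by
  have h' : ∀ i, ∃ w : n → F, w ≠ 0 ∧ (X + ρ i • Y) *ᵥ w = 0 := fun i =>
    exists_mulVec_eq_zero_iff.2 (h i)
  choose w hw0 hw using h'
  set Z := X + t • Y with hZ
  have hZu : IsUnit Z.det := isUnit_iff_ne_zero.2 ht
  have hne : ∀ i, t - ρ i ≠ 0 := fun i hi => by
    rw [sub_eq_zero] at hi
    exact ht (by rw [hZ, hi]; exact h i)
  have hX : X = Z - t • Y := by simp [hZ]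
  have hYw : ∀ i, Y *ᵥ w i = (t - ρ i)⁻¹ • (Z *ᵥ w i) := fun i => by
    have h1 := hw i
    have h2 : X + ρ i • Y = Z - (t - ρ i) • Y := by rw [hX, sub_smul]; abel
    rw [h2, sub_mulVec, sub_eq_zero, smul_mulVec] at h1
    rw [h1, smul_smul, inv_mul_cancel₀ (hne i), one_smul]
  have hli : LinearIndependent F w := by
    refine Module.End.eigenvectors_linearIndependent' (toLin' (Z⁻¹ * Y)) (fun i => (t - ρ i)⁻¹)
      (fun i j hij => hρ (by simpa using hij)) w fun i => ?_
    rw [Module.End.hasEigenvector_iff, Module.End.mem_eigenspace_iff]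
    refine ⟨?_, hw0 i⟩
    rw [toLin'_apply, ← mulVec_mulVec, hYw, mulVec_smul, mulVec_mulVec, nonsing_inv_mul _ hZu,
      one_mulVec]
  set W : Matrix n n F := (Matrix.of w)ᵀ with hW
  have hWu : IsUnit W.det :=
    (isUnit_iff_isUnit_det W).1 (linearIndependent_cols_iff_isUnit.1 hli)
  have hYW : Y = Z * W * diagonal (fun i => (t - ρ i)⁻¹) * W⁻¹ := by
    have : Y * W = Z * W * diagonal (fun i => (t - ρ i)⁻¹) := by
      ext i j
      have := congrFun (hYw j) i
      rw [mul_diagonal, mul_comm]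
      simpa [mulVec, dotProduct, Matrix.mul_apply, hW] using this
    rw [← this, mul_nonsing_inv_cancel_right _ _ hWu]
  have hZW : Z = Z * W * diagonal (fun _ => 1) * W⁻¹ := by
    simp [mul_nonsing_inv_cancel_right _ _ hWu]
  refine SlicesRankLE.of_mul_diagonal_mul (Z * W) W⁻¹
    ![0, fun i => 1 - t * (t - ρ i)⁻¹, fun i => (t - ρ i)⁻¹] fun k => ?_
  fin_cases k
  · simp
  · simp only [Fin.mk_one, cons_val_one, cons_val_zero]
    have : diagonal (fun i => 1 - t * (t - ρ i)⁻¹) =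
        diagonal (fun _ : n => (1 : F)) - t • diagonal (fun i => (t - ρ i)⁻¹) := by
      ext i j
      by_cases hij : i = j <;> simp [hij]
    rw [this, Matrix.mul_sub, Matrix.sub_mul, ← hZW, Matrix.mul_smul, Matrix.smul_mul, ← hYW, hX]
  · simpa using hYW

open Filter Topology in
/-- Persistence of a simple zero of a function of two variables. -/
theorem eventually_exists_zero {F : Type*} [RCLike F] {f : F × F → F} (hf : ContDiff F 1 f)
    {z d : F} (hz : f (0, z) = 0) (hd : HasDerivAt (fun t => f (0, t)) d z) (hd0 : d ≠ 0)
    {U : Set F} (hU : U ∈ 𝓝 z) : ∀ᶠ s in 𝓝 (0 : F), ∃ t ∈ U, f (s, t) = 0 := by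
  have hs : HasStrictFDerivAt f (fderiv F f (0, z)) (0, z) :=
    hf.contDiffAt.hasStrictFDerivAt one_ne_zero
  -- The map `(s, t) ↦ (s, f (s, t))` has surjective derivative at `(0, z)` because `d ≠ 0`, so it
  -- carries neighbourhoods of `(0, z)` onto neighbourhoods of `(0, 0)`.
  have hG := (hasStrictFDerivAt_fst (𝕜 := F) (p := ((0 : F), z))).prodMk hs
  have hd' : fderiv F f (0, z) (0, 1) = d := by
    have h1 : HasDerivAt (fun t : F => ((0 : F), t)) (0, 1) z :=
      (hasDerivAt_const z (0 : F)).prodMk (hasDerivAt_id z)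
    exact (hs.hasFDerivAt.comp_hasDerivAt z h1).unique hd
  have hsurj : ((ContinuousLinearMap.fst F F F).prod (fderiv F f (0, z))).range = ⊤ := by
    rw [LinearMap.range_eq_top]
    rintro ⟨x, y⟩
    refine ⟨(x, d⁻¹ * (y - fderiv F f (0, z) (x, 0))), ?_⟩
    have : ((x, d⁻¹ * (y - fderiv F f (0, z) (x, 0))) : F × F) =
        (x, 0) + (d⁻¹ * (y - fderiv F f (0, z) (x, 0))) • ((0 : F), (1 : F)) := by simp
    simp only [ContinuousLinearMap.coe_coe, ContinuousLinearMap.prod_apply,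
      ContinuousLinearMap.coe_fst', Prod.mk.injEq, true_and]
    rw [this, map_add, map_smul, hd', smul_eq_mul]
    field_simp
    ring
  have hmap := hG.map_nhds_eq_of_surj hsurj
  have hmem : (Set.univ ×ˢ U : Set (F × F)) ∈ 𝓝 ((0 : F), z) :=
    prod_mem_nhds univ_mem hU
  have himg := image_mem_map (m := fun p : F × F => (p.1, f p)) hmem
  rw [hmap, hz] at himg
  have hc : Tendsto (fun s : F => (s, (0 : F))) (𝓝 0) (𝓝 (0, 0)) :=
    (continuous_id.prodMk continuous_const).tendsto' _ _ rfl
  filter_upwards [hc himg] with s hs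
  obtain ⟨⟨p, q⟩, hp, hpq⟩ := hs
  simp only [Prod.mk.injEq] at hpq
  obtain ⟨rfl, h2⟩ := hpq
  exact ⟨q, hp.2, h2⟩

-- Each simple root moves within its own neighbourhood as `s` leaves `0`. Disjoint neighbourhoods
-- keep the roots distinct, and a point `t₀` off the roots keeps the pencil regular.
open Filter Topology in
theorem exists_slicesRankLE_perturb [RCLike F] (N N' M M' : Matrix n n F) (K : F) (hK : K ≠ 0)
    (ρ : n → F) (hρ : Function.Injective ρ)
    (h : ∀ t : F, (N + t • N').det = K * ∏ i, (t - ρ i)) :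
    ∃ s : F, s ≠ 0 ∧ SlicesRankLE ![0, N + s • M, N' + s • M'] (Fintype.card n) := by
  let f : F × F → F := fun p => ((N + p.1 • M) + p.2 • (N' + p.1 • M')).det
  have hf : ContDiff F 1 f := by
    simp only [f, det_apply', Matrix.add_apply, Matrix.smul_apply, smul_eq_mul]
    fun_prop
  have hf0 : ∀ t, f (0, t) = K * ∏ i, (t - ρ i) := fun t => by simp [f, h]
  obtain ⟨U, hU, hdisj⟩ : ∃ U : n → Set F, (∀ i, U i ∈ 𝓝 (ρ i)) ∧
      ∀ i j, i ≠ j → Disjoint (U i) (U j) := by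
    obtain ⟨U, hU, hd⟩ := (Set.finite_range ρ).t2_separation
    refine ⟨fun i => U (ρ i), fun i => (hU _).2.mem_nhds (hU _).1, fun i j hij => ?_⟩
    exact hd ⟨i, rfl⟩ ⟨j, rfl⟩ (hρ.ne hij)
  have hroot : ∀ i, ∀ᶠ s in 𝓝 (0 : F), ∃ t ∈ U i, f (s, t) = 0 := fun i => by
    have hder : HasDerivAt (fun t => f (0, t)) (K * ∏ j ∈ Finset.univ.erase i, (ρ i - ρ j))
        (ρ i) := by
      simp only [hf0, ← Finset.mul_prod_erase Finset.univ _ (Finset.mem_univ i)]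
      have h1 : HasDerivAt (fun t => t - ρ i) 1 (ρ i) := (hasDerivAt_id _).sub_const _
      have h2 : DifferentiableAt F (fun t => ∏ j ∈ Finset.univ.erase i, (t - ρ j)) (ρ i) := by
        fun_prop
      simpa using (h1.mul h2.hasDerivAt).const_mul K
    refine eventually_exists_zero hf ?_ hder ?_ (hU i)
    · rw [hf0, Finset.prod_eq_zero (Finset.mem_univ i) (sub_self _), mul_zero]
    · refine mul_ne_zero hK (Finset.prod_ne_zero_iff.2 fun j hj => sub_ne_zero.2 ?_)
      exact hρ.ne (Finset.ne_of_mem_erase hj).symm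
  obtain ⟨t₀, ht₀⟩ := Infinite.exists_notMem_finset (Finset.univ.image ρ)
  have ht₀' : f (0, t₀) ≠ 0 := by
    rw [hf0]
    refine mul_ne_zero hK (Finset.prod_ne_zero_iff.2 fun j _ => sub_ne_zero.2 fun h => ht₀ ?_)
    simp [h]
  have hne : ∀ᶠ s in 𝓝 (0 : F), f (s, t₀) ≠ 0 := by
    have : Continuous fun s => f (s, t₀) := hf.continuous.comp (by fun_prop)
    exact this.continuousAt.eventually_ne ht₀'
  -- The punctured neighbourhood provides `s ≠ 0`, which the later rescalings by `s⁻¹` require.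
  have hev := ((eventually_all.2 hroot).and hne).filter_mono (nhdsWithin_le_nhds (s := {0}ᶜ))
  obtain ⟨s, ⟨hs, hs0⟩, hsne⟩ := (hev.and self_mem_nhdsWithin).exists
  choose τ hτU hτ using hs
  refine ⟨s, hsne, slicesRankLE_pencil _ _ τ (fun i j hij => ?_) hτ t₀ hs0⟩
  by_contra hne
  exact (Set.disjoint_left.1 (hdisj i j hne) (hτU i)) (hij ▸ hτU j)

end Pencil

/-! ### Large diagonal corrections in block form -/

section Blocks

theorem exists_injective_notMem {F ι : Type*} [Fintype ι] [Infinite F] (S : Finset F) :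
    ∃ ρ : ι → F, Function.Injective ρ ∧ ∀ i, ρ i ∉ S := by
  have : Infinite {x // x ∉ S} := (Finset.finite_toSet S).infinite_compl.to_subtype
  let e := (Fintype.equivFin ι).toEmbedding.trans
    (Fin.valEmbedding.trans (Infinite.natEmbedding {x // x ∉ S}))
  exact ⟨fun i => (e i).1, fun i j h => e.injective (Subtype.ext h), fun i => (e i).2⟩

variable {F ι : Type*} [Fintype ι] [DecidableEq ι]

theorem exists_dotProduct_ne_zero [Field F] [Infinite F] {σ : Type*} [Finite σ] (v : σ → ι → F)
    (hv : ∀ j, v j ≠ 0) : ∃ w : ι → F, ∀ j, w ⬝ᵥ v j ≠ 0 := by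
  obtain ⟨f, hf⟩ := Module.exists_dual_forall_apply_ne_zero (K := F) v hv
  refine ⟨fun i => f (Pi.single i 1), fun j => ?_⟩
  convert hf j
  conv_rhs => rw [pi_eq_sum_univ' (v j), map_sum]
  simp [dotProduct, mul_comm]

/-- Subtracting diagonal matrices with one vanishing entry. -/
theorem slicesRankLE_of_add_diagonal [Field F] (ε d d' : ι → F)
    (B C : Matrix (ι ⊕ Unit) (ι ⊕ Unit) F)
    (h : SlicesRankLE ![0, B + fromBlocks (diagonal d) 0 0 0, C + fromBlocks (diagonal d') 0 0 0]
      (Fintype.card ι + 1)) :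
    SlicesRankLE ![fromBlocks (diagonal ε) 0 0 0, B, C] (2 * Fintype.card ι + 1) := by
  have h1 : SlicesRankLE ![diagonal ε, diagonal (-d), diagonal (-d')] (Fintype.card ι) :=
    SlicesRankLE.of_mul_diagonal_mul 1 1 ![ε, -d, -d'] fun k => by fin_cases k <;> simp
  have h2 := (h1.fromBlocks_zero_triple (κ := Unit)).add_triple h
  rw [two_mul, add_assoc]
  refine h2.congr (add_zero _).symm ?_ ?_
  all_goals
    rw [add_comm, add_assoc, fromBlocks_add, diagonal_add]
    simp

/-- In the limit `s → 0` the rescaled pencil is block triangular, with roots `ρ i` from the free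
diagonal and `-b / c` from the corner. -/
theorem slicesRankLE_of_corner_ne_zero [RCLike F] (ε : ι → F) (B₁₁ C₁₁ : Matrix ι ι F)
    (B₁₂ C₁₂ : Matrix ι Unit F) (B₂₁ C₂₁ : Matrix Unit ι F) (b c : F) (hc : c ≠ 0) :
    SlicesRankLE ![fromBlocks (diagonal ε) 0 0 0, fromBlocks B₁₁ B₁₂ B₂₁ (diagonal fun _ => b),
      fromBlocks C₁₁ C₁₂ C₂₁ (diagonal fun _ => c)] (2 * Fintype.card ι + 1) := by
  obtain ⟨ρ, hρ, hρS⟩ := exists_injective_notMem (ι := ι) {-b / c}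
  obtain ⟨s, hs, h⟩ := exists_slicesRankLE_perturb
    (fromBlocks (diagonal fun i => -ρ i) 0 B₂₁ (diagonal fun _ => b))
    (fromBlocks (diagonal fun _ => 1) 0 C₂₁ (diagonal fun _ => c))
    (fromBlocks B₁₁ B₁₂ 0 0) (fromBlocks C₁₁ C₁₂ 0 0) c hc (Sum.elim ρ fun _ => -b / c)
    (Function.Injective.sumElim hρ (Function.injective_of_subsingleton _)
      fun i _ hi => hρS i (by simp [hi])) (fun t => by
        simp only [fromBlocks_smul, fromBlocks_add, smul_zero, add_zero, det_fromBlocks_zero₁₂,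
          ← diagonal_smul, diagonal_add, det_diagonal, Fintype.prod_sum_type, Sum.elim_inl,
          Sum.elim_inr, Pi.smul_apply, smul_eq_mul, mul_one, Finset.univ_unique,
          Finset.prod_singleton]
        have : ∏ i, (-ρ i + t) = ∏ i, (t - ρ i) := Finset.prod_congr rfl fun i _ => by ring
        rw [this]
        field_simp
        ring)
  refine slicesRankLE_of_add_diagonal ε (fun i => s⁻¹ * -ρ i) (fun _ => s⁻¹) _ _ ?_
  -- Scaling the upper rows by `s` makes the added diagonal of order one and the original upper
  -- blocks of order `s`.
  have hU : IsUnit (fromBlocks (s • (1 : Matrix ι ι F)) 0 0 (1 : Matrix Unit Unit F)).det := by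
    rw [det_fromBlocks_zero₁₂, det_smul]
    simp [hs]
  refine SlicesRankLE.of_mul_mul_triple (V := 1) hU (by simp) ?_
  simp only [Fintype.card_sum, Fintype.card_unit] at h
  refine h.congr (by simp) ?_ ?_
  all_goals
    simp only [fromBlocks_add, fromBlocks_smul, fromBlocks_multiply, Matrix.mul_one]
    ext (i | i) (j | j)
    · by_cases hij : i = j
      · subst hij
        simp [Matrix.smul_mul, mul_add, hs, add_comm]
      · simp [hij, Matrix.smul_mul]
    all_goals simp [Matrix.smul_mul]

/-- The lower row of the limit pencil is `χ i * (t - ρ i)`, proportional to the diagonal `(t - ρ i)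
* (w i)⁻¹`. Eliminating it leaves the linear factor `x + t * y`, so the roots are the `ρ i` and `-x
/ y`; `hδ` and `hβ` make this last root exist and differ from the others. -/
theorem slicesRankLE_of_normalized_row [RCLike F] (ε : ι → F) (B₁₁ C₁₁ : Matrix ι ι F)
    (β δ χ w ρ : ι → F) (hρ : Function.Injective ρ) (hw : ∀ i, w i ≠ 0)
    (hδ : ∑ i, χ i * w i * δ i ≠ 0)
    (hβ : ∀ j, ∑ i, χ i * w i * (β i + ρ j * δ i) ≠ 0) :
    SlicesRankLE ![fromBlocks (diagonal ε) 0 0 0,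
      fromBlocks B₁₁ (replicateCol Unit β) (replicateRow Unit fun i => -(χ i * ρ i)) 0,
      fromBlocks C₁₁ (replicateCol Unit δ) (replicateRow Unit χ) 0] (2 * Fintype.card ι + 1) := by
  set x := ∑ i, χ i * w i * β i with hx
  set y := ∑ i, χ i * w i * δ i with hy
  have hβ' : ∀ j, x + ρ j * y ≠ 0 := fun j => by
    convert hβ j using 1
    rw [hx, hy, Finset.mul_sum, ← Finset.sum_add_distrib]
    exact Finset.sum_congr rfl fun i _ => by ring
  have hW : ∏ i, (w i)⁻¹ ≠ 0 := Finset.prod_ne_zero_iff.2 fun i _ => inv_ne_zero (hw i)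
  obtain ⟨s, hs, h⟩ := exists_slicesRankLE_perturb
    (fromBlocks (diagonal fun i => -ρ i * (w i)⁻¹) (replicateCol Unit β)
      (replicateRow Unit fun i => -(χ i * ρ i)) 0)
    (fromBlocks (diagonal fun i => (w i)⁻¹) (replicateCol Unit δ) (replicateRow Unit χ) 0)
    (fromBlocks B₁₁ 0 0 0) (fromBlocks C₁₁ 0 0 0) (-((∏ i, (w i)⁻¹) * y))
    (neg_ne_zero.2 (mul_ne_zero hW hδ)) (Sum.elim ρ fun _ => -x / y)
    (Function.Injective.sumElim hρ (Function.injective_of_subsingleton _)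
      fun j _ hj => hβ' j (by rw [hj]; field_simp; ring)) (fun t => by
        have hfac : fromBlocks (diagonal fun i => -ρ i * (w i)⁻¹) (replicateCol Unit β)
            (replicateRow Unit fun i => -(χ i * ρ i)) 0 +
            t • fromBlocks (diagonal fun i => (w i)⁻¹) (replicateCol Unit δ)
              (replicateRow Unit χ) (0 : Matrix Unit Unit F) =
            fromBlocks 1 0 (replicateRow Unit fun i => χ i * w i) 1 *
            fromBlocks (diagonal fun i => (t - ρ i) * (w i)⁻¹)
              (replicateCol Unit fun i => β i + t * δ i) 0 (diagonal fun _ => -(x + t * y)) := by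
          rw [fromBlocks_smul, fromBlocks_add, fromBlocks_multiply]
          ext (i | i) (j | j)
          · by_cases hij : i = j
            · subst hij
              simp
              ring
            · simp [hij]
          · simp
          · have := hw j
            simp
            field_simp
            ring
          · simp [Matrix.mul_apply, hx, hy, Finset.mul_sum, ← Finset.sum_add_distrib,
              ← sub_eq_add_neg]
            rw [eq_comm, sub_eq_zero]
            exact Finset.sum_congr rfl fun i _ => by ring
        rw [hfac, det_mul, det_fromBlocks_zero₁₂, det_fromBlocks_zero₂₁]
        simp only [det_one, mul_one, one_mul, det_diagonal, Fintype.prod_sum_type, Sum.elim_inl,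
          Sum.elim_inr, Finset.univ_unique, Finset.prod_singleton, Finset.prod_mul_distrib]
        field_simp
        ring)
  refine slicesRankLE_of_add_diagonal ε (fun i => s⁻¹ * (-ρ i * (w i)⁻¹))
    (fun i => s⁻¹ * (w i)⁻¹) _ _ ?_
  have hU : IsUnit (fromBlocks (s • (1 : Matrix ι ι F)) 0 0 (1 : Matrix Unit Unit F)).det := by
    rw [det_fromBlocks_zero₁₂, det_smul]
    simp [hs]
  -- The factor `s⁻¹` on the last column undoes the row scaling there, and the zero corner stays
  -- zero. Only the upper left block is perturbed.
  have hV : IsUnit (fromBlocks (1 : Matrix ι ι F) 0 0 (s⁻¹ • (1 : Matrix Unit Unit F))).det := by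
    rw [det_fromBlocks_zero₁₂, det_smul]
    simp [hs]
  refine SlicesRankLE.of_mul_mul_triple hU hV ?_
  simp only [Fintype.card_sum, Fintype.card_unit] at h
  refine h.congr (by simp) ?_ ?_
  all_goals
    simp only [fromBlocks_add, fromBlocks_smul, fromBlocks_multiply, Matrix.mul_one]
    ext (i | i) (j | j)
    · by_cases hij : i = j
      · subst hij
        simp [Matrix.smul_mul, mul_add]
        field_simp
        ring
      · simp [hij, Matrix.smul_mul, mul_add]
    · simp [Matrix.smul_mul, hs]
    · simp
    · simp

/-- The general linear group acts transitively on pairs of independent row vectors. -/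
theorem exists_vecMul_eq_vecMul_eq [Field F] {α γ α' γ' : ι → F}
    (h : LinearIndependent F ![α, γ]) (h' : LinearIndependent F ![α', γ']) :
    ∃ P : Matrix ι ι F, IsUnit P.det ∧ α ᵥ* P = α' ∧ γ ᵥ* P = γ' := by
  let b := Module.Basis.sumExtend h
  let b' := Module.Basis.sumExtend h'
  have := Module.Finite.finite_basis b
  have := Module.Finite.finite_basis b'
  have : Finite (Module.Basis.sumExtendIndex h) :=
    Finite.of_injective (Sum.inr (α := Fin 2)) Sum.inr_injective
  have : Finite (Module.Basis.sumExtendIndex h') :=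
    Finite.of_injective (Sum.inr (α := Fin 2)) Sum.inr_injective
  have hcard : Nat.card (Module.Basis.sumExtendIndex h) =
      Nat.card (Module.Basis.sumExtendIndex h') := by
    have h1 := Module.finrank_eq_nat_card_basis b
    have h2 := Module.finrank_eq_nat_card_basis b'
    rw [Nat.card_sum] at h1 h2
    omega
  let e := b.equiv b' ((Equiv.refl (Fin 2)).sumCongr (Finite.card_eq.1 hcard).some)
  have he : ∀ i : Fin 2, e (![α, γ] i) = ![α', γ'] i := fun i => by
    have h1 : b (Sum.inl i) = ![α, γ] i := by
      simp only [b, Module.Basis.sumExtend, Module.Basis.reindex_apply, Module.Basis.coe_extend]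
      erw [Equiv.symm_symm, Equiv.trans_apply, Equiv.sumCongr_apply, Sum.map_inl,
        Equiv.Set.sumDiffSubset_apply_inl]
      rfl
    have h2 : b' (Sum.inl i) = ![α', γ'] i := by
      simp only [b', Module.Basis.sumExtend, Module.Basis.reindex_apply, Module.Basis.coe_extend]
      erw [Equiv.symm_symm, Equiv.trans_apply, Equiv.sumCongr_apply, Sum.map_inl,
        Equiv.Set.sumDiffSubset_apply_inl]
      rfl
    rw [← h1, ← h2]
    simp [e]
  refine ⟨(LinearMap.toMatrix' e.toLinearMap)ᵀ, ?_, ?_, ?_⟩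
  · rw [det_transpose, LinearMap.det_toMatrix']
    exact LinearEquiv.isUnit_det' e
  · rw [vecMul_transpose, LinearMap.toMatrix'_mulVec]
    simpa using he 0
  · rw [vecMul_transpose, LinearMap.toMatrix'_mulVec]
    simpa using he 1

/-- Conjugation on the support `μ` of the first slice preserves that slice and can move the
independent pair `(α, γ)` to `(-ρ, 1)`, the normalized form. Generic weights `w` then give the
nonvanishing conditions. -/
theorem slicesRankLE_of_row_independent [RCLike F] {μ κ : Type*} [Fintype μ] [DecidableEq μ]
    [Fintype κ] [DecidableEq κ] (B₁₁ C₁₁ : Matrix (μ ⊕ κ) (μ ⊕ κ) F) (α γ β δ : μ → F)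
    (hαγ : LinearIndependent F ![α, γ]) (hδ : δ ≠ 0) :
    SlicesRankLE ![fromBlocks (fromBlocks 1 0 0 0) 0 0 0,
      fromBlocks B₁₁ (replicateCol Unit (Sum.elim β 0)) (replicateRow Unit (Sum.elim α 0)) 0,
      fromBlocks C₁₁ (replicateCol Unit (Sum.elim δ 0)) (replicateRow Unit (Sum.elim γ 0)) 0]
      (2 * Fintype.card (μ ⊕ κ) + 1) := by
  obtain ⟨i₀, hi₀⟩ := Function.ne_iff.1 hδ
  -- Avoiding this value ensures `β + ρ j • δ ≠ 0` already in the coordinate `i₀`.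
  obtain ⟨ρ, hρ, hρS⟩ := exists_injective_notMem (F := F) (ι := μ ⊕ κ) {-β i₀ / δ i₀}
  have hne : ∀ j, β + ρ j • δ ≠ 0 := fun j hj => hρS j (by
    have := congrFun hj i₀
    simp only [Pi.add_apply, Pi.smul_apply, smul_eq_mul, Pi.zero_apply] at this hi₀
    rw [Finset.mem_singleton]
    field_simp
    linear_combination this)
  have hcard : 1 < Fintype.card μ := by
    have := hαγ.fintype_card_le_finrank
    simp at this
    omega
  obtain ⟨j₁, j₂, hj⟩ := Fintype.one_lt_card_iff.1 hcard
  have hind : LinearIndependent F ![fun i : μ => -ρ (Sum.inl i), fun _ => 1] := by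
    rw [LinearIndependent.pair_iff]
    intro s t hst
    have h1 := congrFun hst j₁
    have h2 := congrFun hst j₂
    simp only [Pi.add_apply, Pi.smul_apply, smul_eq_mul, Pi.zero_apply] at h1 h2
    have h3 : s * (ρ (Sum.inl j₁) - ρ (Sum.inl j₂)) = 0 := by linear_combination h2 - h1
    have hs : s = 0 := (mul_eq_zero.1 h3).resolve_right
      (sub_ne_zero.2 fun h => hj (Sum.inl_injective (hρ h)))
    exact ⟨hs, by simpa [hs] using h1⟩
  obtain ⟨P, hP, hα, hγ⟩ := exists_vecMul_eq_vecMul_eq hαγ hind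
  have hinj : ∀ v : μ → F, v ≠ 0 → P⁻¹ *ᵥ v ≠ 0 := fun v hv h => hv (by
    have : P *ᵥ (P⁻¹ *ᵥ v) = v := by rw [mulVec_mulVec, mul_nonsing_inv _ hP, one_mulVec]
    rw [← this, h, mulVec_zero])
  obtain ⟨w, hw⟩ := exists_dotProduct_ne_zero (F := F)
    (Sum.elim (fun i : μ => (Pi.single i 1 : μ → F))
      (Sum.elim (fun _ : Unit => P⁻¹ *ᵥ δ) fun j : μ ⊕ κ => P⁻¹ *ᵥ (β + ρ j • δ)))
    (by
      rintro (i | i | j)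
      · simp
      · exact hinj _ hδ
      · exact hinj _ (hne j))
  have key := slicesRankLE_of_normalized_row (Sum.elim 1 0 : μ ⊕ κ → F)
    (fromBlocks P⁻¹ 0 0 1 * B₁₁ * fromBlocks P 0 0 1)
    (fromBlocks P⁻¹ 0 0 1 * C₁₁ * fromBlocks P 0 0 1)
    (Sum.elim (P⁻¹ *ᵥ β) 0) (Sum.elim (P⁻¹ *ᵥ δ) 0) (Sum.elim 1 0) (Sum.elim w 1) ρ hρ
    (by
      rintro (i | i)
      · simpa using hw (Sum.inl i)
      · simp)
    (by simpa [dotProduct] using hw (Sum.inr (Sum.inl ())))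
    (fun j => by
      simpa [dotProduct, mulVec_add, mulVec_smul] using hw (Sum.inr (Sum.inr j)))
  have hU : IsUnit (fromBlocks (fromBlocks P⁻¹ 0 0 (1 : Matrix κ κ F)) 0 0
      (1 : Matrix Unit Unit F)).det := by
    simpa [det_fromBlocks_zero₁₂] using hP
  have hV : IsUnit (fromBlocks (fromBlocks P 0 0 (1 : Matrix κ κ F)) 0 0
      (1 : Matrix Unit Unit F)).det := by
    simpa [det_fromBlocks_zero₁₂] using hP
  refine SlicesRankLE.of_mul_mul_triple hU hV ?_
  have hrow : ∀ v v' : μ → F, v ᵥ* P = v' →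
      replicateRow Unit (Sum.elim v (0 : κ → F)) * fromBlocks P 0 0 (1 : Matrix κ κ F) =
        replicateRow Unit (Sum.elim v' 0) := fun v v' h => by
    subst h
    ext i (j | j) <;> simp [Matrix.mul_apply, vecMul, dotProduct]
  have hcol : ∀ v : μ → F,
      fromBlocks P⁻¹ 0 0 (1 : Matrix κ κ F) * replicateCol Unit (Sum.elim v (0 : κ → F)) =
        replicateCol Unit (Sum.elim (P⁻¹ *ᵥ v) (0 : κ → F)) := fun v => by
    ext (j | j) i <;> simp [Matrix.mul_apply, mulVec, dotProduct]
  refine key.congr ?_ ?_ ?_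
  · simp only [fromBlocks_multiply]
    ext ((i | i) | i) ((j | j) | j) <;>
      simp [fromBlocks_multiply, nonsing_inv_mul _ hP, diagonal_apply, one_apply]
  · simp only [fromBlocks_multiply, hcol, hrow _ _ hα, Matrix.zero_mul, Matrix.mul_zero,
      add_zero, zero_add, Matrix.one_mul, Matrix.mul_one]
    congr 2
    ext (j | j) <;> simp
  · simp only [fromBlocks_multiply, hcol, hrow _ _ hγ, Matrix.zero_mul, Matrix.mul_zero,
      add_zero, zero_add, Matrix.one_mul, Matrix.mul_one]
    rfl

end Blocks

/-! ### Thin crosses -/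

section ThinCross

variable {F ι κ : Type*} [Field F]

/-- The row and the column of index `z` of the pair `(B, C)` meet in zeros, and the ranks of the
row pair and of the column pair add up to at most two. -/
def HasThinCross (B C : Matrix ι ι F) (z : ι) : Prop :=
  B z z = 0 ∧ C z z = 0 ∧ ¬(LinearIndependent F ![B z, C z] ∧ (Bᵀ z ≠ 0 ∨ Cᵀ z ≠ 0)) ∧
    ¬(LinearIndependent F ![Bᵀ z, Cᵀ z] ∧ (B z ≠ 0 ∨ C z ≠ 0))

theorem linearIndependent_pair_of_comp {v w : ι → F} (f : κ → ι)
    (h : LinearIndependent F ![v ∘ f, w ∘ f]) : LinearIndependent F ![v, w] := by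
  rw [LinearIndependent.pair_iff] at h ⊢
  intro s t hst
  refine h s t ?_
  funext i
  exact congrFun hst (f i)

theorem HasThinCross.not_row {B C : Matrix ι ι F} {z : ι} (h : HasThinCross B C z) (f : κ → ι) :
    ¬(LinearIndependent F ![fun i => B z (f i), fun i => C z (f i)] ∧
      ((fun i => B (f i) z) ≠ 0 ∨ (fun i => C (f i) z) ≠ 0)) := by
  have hne : ∀ v : ι → F, v ∘ f ≠ 0 → v ≠ 0 := fun v hv h => hv (by rw [h]; rfl)
  exact fun h' => h.2.2.1 ⟨linearIndependent_pair_of_comp f h'.1, h'.2.imp (hne _) (hne _)⟩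

theorem HasThinCross.transpose {B C : Matrix ι ι F} {z : ι} (h : HasThinCross B C z) :
    HasThinCross Bᵀ Cᵀ z :=
  ⟨h.1, h.2.1, h.2.2.2, h.2.2.1⟩

theorem HasThinCross.submatrix {B C : Matrix ι ι F} (f : κ → ι) {z : κ}
    (h : HasThinCross B C (f z)) : HasThinCross (B.submatrix f f) (C.submatrix f f) z :=
  ⟨h.1, h.2.1, h.not_row f, h.transpose.not_row f⟩

theorem exists_eq_smul_of_not_linearIndependent {v w : ι → F}
    (h : ¬LinearIndependent F ![v, w]) : ∃ (u : ι → F) (x y : F), v = x • u ∧ w = y • u := by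
  rw [LinearIndependent.pair_iff] at h
  push Not at h
  obtain ⟨s, t, hst, hne⟩ := h
  by_cases hs : s = 0
  · have ht := hne hs
    refine ⟨v, 1, 0, by simp, ?_⟩
    rw [hs, zero_smul, zero_add] at hst
    simpa using (smul_eq_zero.1 hst).resolve_left ht
  · refine ⟨w, -(s⁻¹ * t), 1, ?_, by simp⟩
    have : s • v = -(t • w) := eq_neg_of_add_eq_zero_left hst
    rw [neg_smul, mul_smul, ← smul_neg, ← this, smul_smul, inv_mul_cancel₀ hs, one_smul]

/-- The matrix with a single nonzero row, given by `α`, and a single nonzero column, given by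
`β`. -/
abbrev crossMatrix (β α : κ → F) : Matrix (κ ⊕ Unit) (κ ⊕ Unit) F :=
  fromBlocks 0 (replicateCol Unit β) (replicateRow Unit α) 0

theorem crossMatrix_row (α : κ → F) :
    crossMatrix 0 α = vecMulVec (Sum.elim 0 1) (Sum.elim α 0) := by
  ext (i | i) (j | j) <;> simp [vecMulVec_apply]

theorem crossMatrix_col (β : κ → F) :
    crossMatrix β 0 = vecMulVec (Sum.elim β 0) (Sum.elim 0 1) := by
  ext (i | i) (j | j) <;> simp [vecMulVec_apply]

theorem crossMatrix_add (β α β' α' : κ → F) :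
    crossMatrix β α + crossMatrix β' α' = crossMatrix (β + β') (α + α') := by
  ext (i | i) (j | j) <;> simp

theorem smul_crossMatrix (t : F) (β α : κ → F) :
    t • crossMatrix β α = crossMatrix (t • β) (t • α) := by
  ext (i | i) (j | j) <;> simp

theorem slicesRankLE_row {α γ : κ → F} (h : ¬LinearIndependent F ![α, γ]) :
    SlicesRankLE ![0, crossMatrix 0 α, crossMatrix 0 γ] 1 := by
  obtain ⟨u, x, y, rfl, rfl⟩ := exists_eq_smul_of_not_linearIndependent h
  refine (SlicesRankLE.pure_triple (Sum.elim 0 1) (Sum.elim u 0) 0 x y).congr (by simp) ?_ ?_ <;>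
    simp [← crossMatrix_row, smul_crossMatrix]

theorem slicesRankLE_col {β δ : κ → F} (h : ¬LinearIndependent F ![β, δ]) :
    SlicesRankLE ![0, crossMatrix β 0, crossMatrix δ 0] 1 := by
  obtain ⟨u, x, y, rfl, rfl⟩ := exists_eq_smul_of_not_linearIndependent h
  refine (SlicesRankLE.pure_triple (Sum.elim u 0) (Sum.elim 0 1) 0 x y).congr (by simp) ?_ ?_ <;>
    simp [← crossMatrix_col, smul_crossMatrix]

theorem not_linearIndependent_zero_left (v : κ → F) : ¬LinearIndependent F ![0, v] :=
  fun h => h.ne_zero 0 rfl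

theorem not_linearIndependent_zero_right (v : κ → F) : ¬LinearIndependent F ![v, 0] :=
  fun h => h.ne_zero 1 rfl

/-- If the column pair is nonzero or the row pair vanishes, a pure tensor `w ⊗ e ⊗ (0, y, y')` can
be split off a thin cross so that a tensor of rank at most one remains. -/
theorem exists_slicesRankLE_cross_sub [Nonempty κ] {α γ β δ : κ → F}
    (h1 : ¬(LinearIndependent F ![α, γ] ∧ (β ≠ 0 ∨ δ ≠ 0)))
    (h2 : ¬(LinearIndependent F ![β, δ] ∧ (α ≠ 0 ∨ γ ≠ 0)))
    (h : (β ≠ 0 ∨ δ ≠ 0) ∨ α = 0 ∧ γ = 0) :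
    ∃ (w : κ → F) (y y' : F), w ≠ 0 ∧ (y ≠ 0 ∨ y' ≠ 0) ∧
      SlicesRankLE ![0, crossMatrix (β - y • w) α, crossMatrix (δ - y' • w) γ] 1 := by
  by_cases hli : LinearIndependent F ![β, δ]
  · have hr : α = 0 ∧ γ = 0 := by
      by_contra hc
      exact h2 ⟨hli, by tauto⟩
    refine ⟨β, 1, 0, hli.ne_zero 0, Or.inl one_ne_zero, ?_⟩
    rw [hr.1, hr.2]
    exact slicesRankLE_col (by simpa using not_linearIndependent_zero_left δ)
  · by_cases hc : β ≠ 0 ∨ δ ≠ 0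
    · obtain ⟨u, x, y, rfl, rfl⟩ := exists_eq_smul_of_not_linearIndependent hli
      refine ⟨u, x, y, ?_, ?_, ?_⟩
      · rintro rfl
        simp at hc
      · exact hc.imp (fun h h' => h (by simp [h'])) (fun h h' => h (by simp [h']))
      · simpa using slicesRankLE_row fun h => h1 ⟨h, hc⟩
    · have hr := h.resolve_left hc
      push Not at hc
      refine ⟨1, 1, 0, one_ne_zero, Or.inl one_ne_zero, ?_⟩
      rw [hr.1, hr.2, hc.1, hc.2]
      exact slicesRankLE_col (by simpa using not_linearIndependent_zero_right _)

/-- The nonzero possibilities for the ranks of the row pair and the column pair are at most one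
each, or two and zero; each unit of rank costs one pure tensor. -/
theorem slicesRankLE_cross [Nonempty κ] {α γ β δ : κ → F}
    (h1 : ¬(LinearIndependent F ![α, γ] ∧ (β ≠ 0 ∨ δ ≠ 0)))
    (h2 : ¬(LinearIndependent F ![β, δ] ∧ (α ≠ 0 ∨ γ ≠ 0))) :
    SlicesRankLE ![0, crossMatrix β α, crossMatrix δ γ] 2 := by
  have aux : ∀ {α γ β δ : κ → F}, ¬(LinearIndependent F ![α, γ] ∧ (β ≠ 0 ∨ δ ≠ 0)) →
      ¬(LinearIndependent F ![β, δ] ∧ (α ≠ 0 ∨ γ ≠ 0)) → ((β ≠ 0 ∨ δ ≠ 0) ∨ α = 0 ∧ γ = 0) →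
      SlicesRankLE ![0, crossMatrix β α, crossMatrix δ γ] 2 := by
    intro α γ β δ h1 h2 h
    obtain ⟨w, y, y', -, -, hw⟩ := exists_slicesRankLE_cross_sub h1 h2 h
    refine (hw.add_triple (SlicesRankLE.pure_triple (Sum.elim w 0) (Sum.elim 0 1) 0 y y')).congr
      (by simp) ?_ ?_ <;>
      simp [← crossMatrix_col, smul_crossMatrix, crossMatrix_add]
  by_cases h : (β ≠ 0 ∨ δ ≠ 0) ∨ α = 0 ∧ γ = 0
  · exact aux h1 h2 h
  · refine SlicesRankLE.of_transpose_triple ?_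
    refine (aux h2 h1 (by tauto)).congr (by simp) ?_ ?_ <;>
      simp [crossMatrix, fromBlocks_transpose]

end ThinCross

/-! ### Deleting a kernel index -/

section Removal

variable {F ι : Type*} [Field F] [DecidableEq ι]

/-- Splitting off one index. -/
noncomputable def splitIndex (z : ι) : {i // i ≠ z} ⊕ Unit ≃ ι :=
  Equiv.ofBijective (Sum.elim Subtype.val fun _ => z) <| by
    constructor
    · rintro (i | i) (j | j) h
      · exact congrArg _ (Subtype.ext h)
      · exact (i.2 h).elim
      · exact (j.2 h.symm).elim
      · rfl
    · intro i
      by_cases h : i = z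
      · exact ⟨Sum.inr (), h.symm⟩
      · exact ⟨Sum.inl ⟨i, h⟩, rfl⟩

@[simp]
theorem splitIndex_inl (z : ι) (i : {i // i ≠ z}) : splitIndex z (Sum.inl i) = i := rfl

@[simp]
theorem splitIndex_inr (z : ι) (i : Unit) : splitIndex z (Sum.inr i) = z := rfl

theorem submatrix_splitIndex (B : Matrix ι ι F) (z : ι) (h : B z z = 0) :
    B.submatrix (splitIndex z) (splitIndex z) =
      fromBlocks (B.submatrix Subtype.val Subtype.val)
        (replicateCol Unit fun i : {i // i ≠ z} => B i z)
        (replicateRow Unit fun i : {i // i ≠ z} => B z i) 0 := by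
  ext (i | i) (j | j) <;> simp [h]

theorem submatrix_splitIndex_diagonal (χ : ι → F) (z : ι) (h : χ z = 0) :
    (diagonal χ).submatrix (splitIndex z) (splitIndex z) =
      fromBlocks (diagonal fun i : {i // i ≠ z} => χ i) 0 0 0 := by
  ext (i | i) (j | j)
  · simp [diagonal_apply, Subtype.ext_iff]
  · simp [i.2]
  · simp [j.2.symm]
  · simp [h]

variable {B C : Matrix ι ι F} {z : ι}

theorem slicesRankLE_of_hasThinCross [Fintype ι] [Nontrivial ι] {χ : ι → F} (hχ : χ z = 0)
    (h : HasThinCross B C z) {r : ℕ}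
    (hr : SlicesRankLE ![diagonal fun i : {i // i ≠ z} => χ i,
      B.submatrix Subtype.val Subtype.val, C.submatrix Subtype.val Subtype.val] r) :
    SlicesRankLE ![diagonal χ, B, C] (r + 2) := by
  have : Nonempty {i // i ≠ z} := nonempty_subtype.2 (exists_ne z)
  refine SlicesRankLE.of_submatrix_triple (splitIndex z) (splitIndex z) ?_
  have hc := slicesRankLE_cross (h.not_row (Subtype.val : {i // i ≠ z} → ι))
    (h.transpose.not_row (Subtype.val : {i // i ≠ z} → ι))
  refine (hr.fromBlocks_zero_triple.add_triple hc).congr ?_ ?_ ?_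
  · rw [submatrix_splitIndex_diagonal _ _ hχ, add_zero]
  · rw [submatrix_splitIndex _ _ h.1, fromBlocks_add]
    simp
  · rw [submatrix_splitIndex _ _ h.2.1, fromBlocks_add]
    simp

end Removal

/-! ### The dichotomy for a diagonal first slice -/

section Diagonal

theorem two_mul_card_sub_one {ι κ : Type*} [Fintype ι] [Fintype κ] (e : κ ⊕ Unit ≃ ι) :
    2 * Fintype.card ι - 1 = 2 * Fintype.card κ + 1 := by
  rw [← Fintype.card_congr e, Fintype.card_sum, Fintype.card_unit]
  omega

theorem diagonal_submatrix_swap {F ι : Type*} [Zero F] [DecidableEq ι] {χ : ι → F} {z z' : ι}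
    (hz : χ z = 0) (hz' : χ z' = 0) :
    (diagonal χ).submatrix id (Equiv.swap z z') = diagonal χ := by
  ext i j
  rw [submatrix_apply, id, diagonal_apply, diagonal_apply]
  by_cases hj : j = z
  · subst hj
    rw [Equiv.swap_apply_left]
    split_ifs <;> simp_all
  · by_cases hj' : j = z'
    · subst hj'
      rw [Equiv.swap_apply_right]
      split_ifs <;> simp_all
    · rw [Equiv.swap_apply_of_ne_of_ne hj hj']

variable {F ι : Type*} [RCLike F] [Fintype ι] [DecidableEq ι]

theorem slicesRankLE_of_diagonal_entry_ne_zero {χ : ι → F} {B C : Matrix ι ι F} {z : ι}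
    (hz : χ z = 0) (hC : C z z ≠ 0) :
    SlicesRankLE ![diagonal χ, B, C] (2 * Fintype.card ι - 1) := by
  rw [two_mul_card_sub_one (splitIndex z)]
  refine SlicesRankLE.of_submatrix_triple (splitIndex z) (splitIndex z) ?_
  refine (slicesRankLE_of_corner_ne_zero (fun i : {i // i ≠ z} => χ i)
    (B.submatrix Subtype.val Subtype.val) (C.submatrix Subtype.val Subtype.val)
    (replicateCol Unit fun i : {i // i ≠ z} => B i z)
    (replicateCol Unit fun i : {i // i ≠ z} => C i z)
    (replicateRow Unit fun i : {i // i ≠ z} => B z i)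
    (replicateRow Unit fun i : {i // i ≠ z} => C z i) (B z z) (C z z) hC).congr
    (submatrix_splitIndex_diagonal _ _ hz) ?_ ?_ <;>
  ext (i | i) (j | j) <;> simp

/-- Swapping the columns `z` and `z'` moves the entry to the diagonal and leaves `diagonal χ`
unchanged, as both columns vanish there. -/
theorem slicesRankLE_of_entry_ne_zero {χ : ι → F} {B C : Matrix ι ι F} {z z' : ι}
    (hz : χ z = 0) (hz' : χ z' = 0) (h : B z z' ≠ 0 ∨ C z z' ≠ 0) :
    SlicesRankLE ![diagonal χ, B, C] (2 * Fintype.card ι - 1) := by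
  wlog hC : C z z' ≠ 0 generalizing B C
  · exact (this h.symm (h.resolve_right hC)).swap_slices
  refine SlicesRankLE.of_submatrix_triple (Equiv.refl ι) (Equiv.swap z z') ?_
  refine (slicesRankLE_of_diagonal_entry_ne_zero (χ := χ) (z := z) hz ?_).congr
    (diagonal_submatrix_swap hz hz') rfl rfl
  simpa using hC

theorem slicesRankLE_of_diagonal_row_independent {χ : ι → F} {B C : Matrix ι ι F} {z : ι}
    (hχ : ∀ i, χ i = 0 ∨ χ i = 1) (hz : χ z = 0)
    (hB : ∀ i j, χ i = 0 → χ j = 0 → B i j = 0) (hC : ∀ i j, χ i = 0 → χ j = 0 → C i j = 0)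
    (hli : LinearIndependent F ![B z, C z]) (hcol : Cᵀ z ≠ 0) :
    SlicesRankLE ![diagonal χ, B, C] (2 * Fintype.card ι - 1) := by
  let f : ({i // χ i ≠ 0} ⊕ {i // χ i = 0 ∧ i ≠ z}) ⊕ Unit → ι :=
    Sum.elim (Sum.elim Subtype.val Subtype.val) fun _ => z
  have hf : Function.Bijective f := by
    constructor
    · rintro ((i | i) | i) ((j | j) | j) h
      · exact congrArg _ (congrArg _ (Subtype.ext h))
      · exact (i.2 ((congrArg χ h).trans j.2.1)).elim
      · exact (i.2 ((congrArg χ h).trans hz)).elim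
      · exact (j.2 ((congrArg χ h).symm.trans i.2.1)).elim
      · exact congrArg _ (congrArg _ (Subtype.ext h))
      · exact (i.2.2 h).elim
      · exact (j.2 ((congrArg χ h).symm.trans hz)).elim
      · exact (j.2.2 h.symm).elim
      · rfl
    · intro i
      by_cases h : χ i = 0
      · by_cases hi : i = z
        · exact ⟨Sum.inr (), hi.symm⟩
        · exact ⟨Sum.inl (Sum.inr ⟨i, h, hi⟩), rfl⟩
      · exact ⟨Sum.inl (Sum.inl ⟨i, h⟩), rfl⟩
  let e := Equiv.ofBijective f hf
  have hli' : LinearIndependent F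
      ![fun i : {i // χ i ≠ 0} => B z i, fun i : {i // χ i ≠ 0} => C z i] := by
    rw [LinearIndependent.pair_iff] at hli ⊢
    intro s t hst
    refine hli s t ?_
    funext i
    by_cases hi : χ i = 0
    · simp [hB z i hz hi, hC z i hz hi]
    · exact congrFun hst ⟨i, hi⟩
  have hcol' : (fun i : {i // χ i ≠ 0} => C i z) ≠ 0 := fun h => hcol (by
    funext i
    by_cases hi : χ i = 0
    · exact hC i z hi hz
    · exact congrFun h ⟨i, hi⟩)
  have key := slicesRankLE_of_row_independent
    (B.submatrix (e ∘ Sum.inl) (e ∘ Sum.inl)) (C.submatrix (e ∘ Sum.inl) (e ∘ Sum.inl))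
    (fun i : {i // χ i ≠ 0} => B z i) (fun i : {i // χ i ≠ 0} => C z i)
    (fun i : {i // χ i ≠ 0} => B i z) (fun i : {i // χ i ≠ 0} => C i z) hli' hcol'
  rw [two_mul_card_sub_one e]
  refine SlicesRankLE.of_submatrix_triple e e (key.congr ?_ ?_ ?_)
  · ext ((i | i) | i) ((j | j) | j)
    · have h1 : χ j = 1 := (hχ j).resolve_left j.2
      by_cases hij : i = j
      · simp [e, f, hij, h1]
      · have hne : (i : ι) ≠ j := fun h => hij (Subtype.ext h)
        simp [e, f, hij, hne]
    · have : (i : ι) ≠ j := fun h => i.2 ((congrArg χ h).trans j.2.1)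
      simp [e, f, this]
    · have : (i : ι) ≠ z := fun h => i.2 ((congrArg χ h).trans hz)
      simp [e, f, this]
    all_goals simp [e, f, diagonal_apply, hz]
    · rintro h
      exact i.2.1
    · rintro h
      exact i.2.1
    · rintro h
      exact i.2.1
  · ext ((i | i) | i) ((j | j) | j) <;>
      simp [e, f, hB z z hz hz]
    · exact hB _ _ i.2.1 hz
    · exact hB _ _ hz j.2.1
  · ext ((i | i) | i) ((j | j) | j) <;>
      simp [e, f, hC z z hz hz]
    · exact hC _ _ i.2.1 hz
    · exact hC _ _ hz j.2.1

theorem slicesRankLE_of_row_independent_of_col_ne_zero {χ : ι → F} {B C : Matrix ι ι F} {z : ι}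
    (hχ : ∀ i, χ i = 0 ∨ χ i = 1) (hz : χ z = 0)
    (hB : ∀ i j, χ i = 0 → χ j = 0 → B i j = 0) (hC : ∀ i j, χ i = 0 → χ j = 0 → C i j = 0)
    (hli : LinearIndependent F ![B z, C z]) (hcol : Bᵀ z ≠ 0 ∨ Cᵀ z ≠ 0) :
    SlicesRankLE ![diagonal χ, B, C] (2 * Fintype.card ι - 1) := by
  by_cases h : Cᵀ z ≠ 0
  · exact slicesRankLE_of_diagonal_row_independent hχ hz hB hC hli h
  · refine SlicesRankLE.swap_slices ?_
    refine slicesRankLE_of_diagonal_row_independent hχ hz hC hB ?_ (hcol.resolve_right h)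
    rw [LinearIndependent.pair_iff] at hli ⊢
    intro s t hst
    exact (hli t s (by rw [add_comm]; exact hst)).symm

/-- Either the expected bound holds, or all the crosses through the kernel indices are thin. -/
theorem slicesRankLE_or_hasThinCross {χ : ι → F} (hχ : ∀ i, χ i = 0 ∨ χ i = 1)
    (B C : Matrix ι ι F) :
    SlicesRankLE ![diagonal χ, B, C] (2 * Fintype.card ι - 1) ∨
      ∀ z, χ z = 0 → HasThinCross B C z := by
  by_contra! hcon
  obtain ⟨hr, z, hz, hthin⟩ := hcon
  have hB : ∀ i j, χ i = 0 → χ j = 0 → B i j = 0 := fun i j hi hj => by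
    by_contra h
    exact hr (slicesRankLE_of_entry_ne_zero hi hj (Or.inl h))
  have hC : ∀ i j, χ i = 0 → χ j = 0 → C i j = 0 := fun i j hi hj => by
    by_contra h
    exact hr (slicesRankLE_of_entry_ne_zero hi hj (Or.inr h))
  refine hthin ⟨hB z z hz hz, hC z z hz hz, fun h => hr ?_, fun h => hr ?_⟩
  · exact slicesRankLE_of_row_independent_of_col_ne_zero hχ hz hB hC h.1 h.2
  · refine SlicesRankLE.of_transpose_triple ?_
    rw [diagonal_transpose]
    exact slicesRankLE_of_row_independent_of_col_ne_zero hχ hz (fun i j hi hj => hB j i hj hi)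
      (fun i j hi hj => hC j i hj hi) h.1 h.2

end Diagonal

/-! ### Rank normal form and the corank one case -/

section NormalForm

variable {F ι : Type*} [Fintype ι] [DecidableEq ι]

theorem exists_mul_mul_eq_diagonal [Field F] (A : Matrix ι ι F) :
    ∃ (U V : Matrix ι ι F) (χ : ι → F), IsUnit U.det ∧ IsUnit V.det ∧ U * A * V = diagonal χ ∧
      ∀ i, χ i = 0 ∨ χ i = 1 := by
  classical
  obtain ⟨L, L', D, h⟩ := Pivot.exists_list_transvec_mul_mul_list_transvec_eq_diagonal A
  let c : ι → F := fun i => if D i = 0 then 1 else (D i)⁻¹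
  refine ⟨diagonal c * (L.map TransvectionStruct.toMatrix).prod,
    (L'.map TransvectionStruct.toMatrix).prod, fun i => c i * D i, ?_, ?_, ?_, fun i => ?_⟩
  · rw [det_mul, TransvectionStruct.det_toMatrix_prod, mul_one, det_diagonal, isUnit_iff_ne_zero,
      Finset.prod_ne_zero_iff]
    intro i _
    by_cases hi : D i = 0 <;> simp [c, hi]
  · rw [TransvectionStruct.det_toMatrix_prod]
    exact isUnit_one
  · rw [Matrix.mul_assoc, Matrix.mul_assoc, ← Matrix.mul_assoc _ A, h, diagonal_mul_diagonal]
  · by_cases hi : D i = 0 <;> simp [c, hi]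

/-- After diagonalizing `A`, both kernel vectors are supported on zeros of `χ`, so a nonzero pairing
exposes a nonzero entry of the third slice at kernel indices. -/
theorem slicesRankLE_of_kernel_pairing [RCLike F] {A B C : Matrix ι ι F} {u v : ι → F}
    (hu : u ᵥ* A = 0) (hv : A *ᵥ v = 0) (huv : u ⬝ᵥ C *ᵥ v ≠ 0) :
    SlicesRankLE ![A, B, C] (2 * Fintype.card ι - 1) := by
  obtain ⟨U, V, χ, hU, hV, hχ, -⟩ := exists_mul_mul_eq_diagonal A
  refine SlicesRankLE.of_mul_mul_triple hU hV ?_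
  rw [hχ]
  have hu' : (u ᵥ* U⁻¹) ᵥ* diagonal χ = 0 := by
    rw [← hχ, vecMul_vecMul, Matrix.mul_assoc, nonsing_inv_mul_cancel_left _ _ hU,
      ← vecMul_vecMul, hu, zero_vecMul]
  have hv' : diagonal χ *ᵥ (V⁻¹ *ᵥ v) = 0 := by
    rw [← hχ, mulVec_mulVec, mul_nonsing_inv_cancel_right _ _ hV, ← mulVec_mulVec, hv,
      mulVec_zero]
  have huv' : (u ᵥ* U⁻¹) ⬝ᵥ (U * C * V) *ᵥ (V⁻¹ *ᵥ v) ≠ 0 := by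
    rwa [mulVec_mulVec, mul_nonsing_inv_cancel_right _ _ hV, dotProduct_mulVec, vecMul_vecMul,
      nonsing_inv_mul_cancel_left _ _ hU, ← dotProduct_mulVec]
  obtain ⟨i, -, hi⟩ := Finset.exists_ne_zero_of_sum_ne_zero huv'
  obtain ⟨j, -, hj⟩ := Finset.exists_ne_zero_of_sum_ne_zero (right_ne_zero_of_mul hi)
  refine slicesRankLE_of_entry_ne_zero (z := i) (z' := j) ?_ ?_ (Or.inr (left_ne_zero_of_mul hj))
  · have := congrFun hu' i
    rw [vecMul_diagonal] at this
    exact (mul_eq_zero.1 this).resolve_left (left_ne_zero_of_mul hi)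
  · have := congrFun hv' j
    rw [mulVec_diagonal] at this
    exact (mul_eq_zero.1 this).resolve_right (right_ne_zero_of_mul hj)

theorem exists_det_sub_smul_one_ne_zero [Field F] [Infinite F] (B : Matrix ι ι F) :
    ∃ t : F, (B - t • (1 : Matrix ι ι F)).det ≠ 0 := by
  classical
  obtain ⟨t, ht⟩ := Infinite.exists_notMem_finset B.charpoly.roots.toFinset
  refine ⟨t, fun h => ht ?_⟩
  rw [Multiset.mem_toFinset, Polynomial.mem_roots B.charpoly_monic.ne_zero, Polynomial.IsRoot,
    eval_charpoly, ← neg_sub, det_neg, scalar_apply, ← smul_one_eq_diagonal, h, mul_zero]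

/-- For `E = B - t • 1` invertible, normalizing `x ⬝ᵥ E⁻¹ *ᵥ w = 1` makes `E - vecMulVec w x`
singular, with left kernel vector `x ᵥ* E⁻¹` and right kernel vector `E⁻¹ *ᵥ w`. A generic `x` makes
these pair nontrivially under the slice `1`. -/
theorem exists_slicesRankLE_one_sub [RCLike F] (B C : Matrix ι ι F) {w : ι → F} (hw : w ≠ 0) :
    ∃ x : ι → F, SlicesRankLE ![1, B - vecMulVec w x, C] (2 * Fintype.card ι - 1) := by
  obtain ⟨t, ht⟩ := exists_det_sub_smul_one_ne_zero B
  set E := B - t • (1 : Matrix ι ι F) with hE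
  have hEu : IsUnit E.det := isUnit_iff_ne_zero.2 ht
  have hinj : ∀ v : ι → F, v ≠ 0 → E⁻¹ *ᵥ v ≠ 0 := fun v hv h => hv (by
    have : E *ᵥ (E⁻¹ *ᵥ v) = v := by rw [mulVec_mulVec, mul_nonsing_inv _ hEu, one_mulVec]
    rw [← this, h, mulVec_zero])
  obtain ⟨y, hy⟩ := exists_dotProduct_ne_zero (F := F)
    ![E⁻¹ *ᵥ w, E⁻¹ *ᵥ (E⁻¹ *ᵥ w)] (by
      intro j
      fin_cases j
      · exact hinj _ hw
      · exact hinj _ (hinj _ hw))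
  have hy0 : y ⬝ᵥ E⁻¹ *ᵥ w ≠ 0 := hy 0
  have hy1 : y ⬝ᵥ E⁻¹ *ᵥ (E⁻¹ *ᵥ w) ≠ 0 := hy 1
  set x := (y ⬝ᵥ E⁻¹ *ᵥ w)⁻¹ • y with hx
  have hx1 : x ⬝ᵥ E⁻¹ *ᵥ w = 1 := by
    rw [hx, smul_dotProduct, smul_eq_mul, inv_mul_cancel₀ hy0]
  refine ⟨x, ?_⟩
  have key := slicesRankLE_of_kernel_pairing (A := E - vecMulVec w x) (B := C) (C := 1)
    (u := x ᵥ* E⁻¹) (v := E⁻¹ *ᵥ w) (by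
      rw [vecMul_sub, vecMul_vecMul, nonsing_inv_mul _ hEu, vecMul_one, vecMul_vecMulVec,
        ← dotProduct_mulVec, hx1]
      simp) (by
      rw [sub_mulVec, mulVec_mulVec, mul_nonsing_inv _ hEu, one_mulVec, vecMulVec_mulVec, hx1]
      simp) (by
      rw [one_mulVec, ← dotProduct_mulVec, hx, smul_dotProduct]
      exact smul_ne_zero (inv_ne_zero hy0) hy1)
  have hcomb := key.combine !![0, 0, 1; 1, 0, t; 0, 1, 0]
  rw [SlicesRankLE.eq_triple fun k => _] at hcomb
  refine hcomb.congr ?_ ?_ ?_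
  · simp [Fin.sum_univ_three]
  · simp [Fin.sum_univ_three, hE]
    abel
  · simp [Fin.sum_univ_three]

/-- When `y ≠ 0`, the combination `C - (y' / y) • B` is unaffected by the simultaneous correction,
so only one slice has to be corrected. -/
theorem exists_slicesRankLE_one_sub_sub [RCLike F] (B C : Matrix ι ι F) {w : ι → F} (hw : w ≠ 0)
    {y y' : F} (hy : y ≠ 0 ∨ y' ≠ 0) :
    ∃ x : ι → F, SlicesRankLE ![1, B - y • vecMulVec w x, C - y' • vecMulVec w x]
      (2 * Fintype.card ι - 1) := by
  wlog h : y ≠ 0 generalizing B C y y'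
  · obtain ⟨x, hx⟩ := this C B hy.symm (hy.resolve_left h)
    exact ⟨x, hx.swap_slices⟩
  obtain ⟨x, hx⟩ := exists_slicesRankLE_one_sub B (C - (y' / y) • B) hw
  refine ⟨y⁻¹ • x, ?_⟩
  have hcomb := hx.combine !![1, 0, 0; 0, 1, 0; 0, y' / y, 1]
  rw [SlicesRankLE.eq_triple fun k => _] at hcomb
  refine hcomb.congr ?_ ?_ ?_
  · simp [Fin.sum_univ_three]
  · simp [Fin.sum_univ_three, vecMulVec_smul, smul_smul, h]
  · simp [Fin.sum_univ_three, vecMulVec_smul, smul_smul, smul_sub, div_eq_mul_inv]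

/-- The pure tensor split off the cross may also have entries `x` in the complementary block at no
cost. Choosing `x` well lowers the rank bound of that block to `2 m - 1`, with `m` its size; two
more pure tensors give `2 m + 1 = 2 n - 1`. -/
theorem slicesRankLE_of_corank_one [RCLike F] [Nontrivial ι] {χ : ι → F} {B C : Matrix ι ι F}
    {z : ι} (hz : χ z = 0) (hχ : ∀ i, i ≠ z → χ i = 1) (h : HasThinCross B C z) :
    SlicesRankLE ![diagonal χ, B, C] (2 * Fintype.card ι - 1) := by
  wlog hcol : (((fun i : {i // i ≠ z} => B i z) ≠ 0 ∨ (fun i : {i // i ≠ z} => C i z) ≠ 0) ∨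
      (fun i : {i // i ≠ z} => B z i) = 0 ∧ (fun i : {i // i ≠ z} => C z i) = 0) generalizing B C
  · refine SlicesRankLE.of_transpose_triple ?_
    rw [diagonal_transpose]
    refine this h.transpose ?_
    simp only [transpose_apply]
    tauto
  have : Nonempty {i // i ≠ z} := nonempty_subtype.2 (exists_ne z)
  obtain ⟨w, y, y', hw, hy, hcross⟩ := exists_slicesRankLE_cross_sub
    (h.not_row (Subtype.val : {i // i ≠ z} → ι))
    (h.transpose.not_row (Subtype.val : {i // i ≠ z} → ι)) hcol
  obtain ⟨x, hx⟩ := exists_slicesRankLE_one_sub_sub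
    (B.submatrix (Subtype.val : {i // i ≠ z} → ι) Subtype.val)
    (C.submatrix Subtype.val Subtype.val) hw hy
  -- The coordinate `1` restores the column removed in `hcross`; the part `x` restores what was
  -- subtracted from the block in `hx`.
  have hpure := SlicesRankLE.pure_triple (Sum.elim w (0 : Unit → F)) (Sum.elim x (1 : Unit → F))
    0 y y'
  have hcard : 2 * Fintype.card ι - 1 = 2 * Fintype.card {i // i ≠ z} - 1 + 1 + 1 := by
    have := two_mul_card_sub_one (splitIndex z)
    have : 0 < Fintype.card {i // i ≠ z} := Fintype.card_pos
    omega
  rw [hcard]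
  refine SlicesRankLE.of_submatrix_triple (splitIndex z) (splitIndex z) ?_
  refine ((hx.fromBlocks_zero_triple.add_triple hcross).add_triple hpure).congr ?_ ?_ ?_
  · rw [submatrix_splitIndex_diagonal _ _ hz, zero_smul, add_zero, add_zero, ← diagonal_one]
    congr 2
    funext i
    exact hχ i i.2
  · rw [submatrix_splitIndex _ _ h.1]
    ext (i | i) (j | j) <;> simp [vecMulVec_apply]
  · rw [submatrix_splitIndex _ _ h.2.1]
    ext (i | i) (j | j) <;> simp [vecMulVec_apply]

end NormalForm

/-! ### Reduction to a singular slice, inductions and tensor rank -/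

section Main

universe u

theorem slicesRankLE_of_forall_det_eq_zero {F ι : Type*} [Field F] [Fintype ι] [DecidableEq ι]
    {r : ℕ} (hroot : ∀ M : Matrix ι ι F, ∃ t, M.charpoly.IsRoot t)
    (h : ∀ A B C : Matrix ι ι F, A.det = 0 → SlicesRankLE ![A, B, C] r)
    (T : Fin 3 → Matrix ι ι F) : SlicesRankLE T r := by
  rw [SlicesRankLE.eq_triple T]
  by_cases h0 : (T 0).det = 0
  · exact h _ _ _ h0
  · have hu : IsUnit (T 0).det := isUnit_iff_ne_zero.2 h0
    obtain ⟨t, ht⟩ := hroot ((T 0)⁻¹ * T 1)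
    rw [Polynomial.IsRoot, eval_charpoly] at ht
    have hdet : (t • T 0 - T 1).det = 0 := by
      have : t • T 0 - T 1 = T 0 * (scalar ι t - (T 0)⁻¹ * T 1) := by
        rw [Matrix.mul_sub, mul_nonsing_inv_cancel_left _ _ hu, scalar_apply,
          ← smul_one_eq_diagonal, Matrix.mul_smul, Matrix.mul_one]
      rw [this, det_mul, ht, mul_zero]
    -- The second row of coefficients recovers `T 1` as `t • T 0 - (t • T 0 - T 1)`.
    have hcomb := (h _ (T 0) (T 2) hdet).combine !![0, 1, 0; -1, t, 0; 0, 0, 1]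
    rw [SlicesRankLE.eq_triple fun k => _] at hcomb
    refine hcomb.congr ?_ ?_ ?_ <;> simp [Fin.sum_univ_three]

theorem slicesRankLE_of_forall_diagonal {F ι : Type*} [Field F] [Fintype ι] [DecidableEq ι]
    {r : ℕ} (h : ∀ (χ : ι → F) (B C : Matrix ι ι F), (∀ i, χ i = 0 ∨ χ i = 1) →
      (∃ z, χ z = 0) → SlicesRankLE ![diagonal χ, B, C] r)
    (A B C : Matrix ι ι F) (hA : A.det = 0) : SlicesRankLE ![A, B, C] r := by
  obtain ⟨U, V, χ, hU, hV, hχ, h01⟩ := exists_mul_mul_eq_diagonal A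
  refine SlicesRankLE.of_mul_mul_triple hU hV ?_
  rw [hχ]
  refine h χ _ _ h01 ?_
  have hdet : (diagonal χ).det = 0 := by rw [← hχ, det_mul, det_mul, hA]; simp
  rw [det_diagonal, Finset.prod_eq_zero_iff] at hdet
  exact hdet.imp fun z hz => hz.2

theorem slicesRankLE_of_card_eq_one {F ι : Type*} [Field F] [Fintype ι]
    (hι : Fintype.card ι = 1) (T : Fin 3 → Matrix ι ι F) : SlicesRankLE T 1 := by
  obtain ⟨i, hi⟩ := Fintype.card_eq_one_iff.1 hι
  convert SlicesRankLE.pure (1 : ι → F) (1 : ι → F) fun k => T k i i using 2 with k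
  ext a b
  simp [hi a, hi b]

theorem card_subtype_ne {ι : Type*} [Fintype ι] [DecidableEq ι] (z : ι) :
    Fintype.card {i // i ≠ z} = Fintype.card ι - 1 := by
  simp

/-- Over the complex numbers, an `n × n × 3` tensor with `n > 0` has rank at most `2 n - 1`. -/
theorem slicesRankLE_of_isAlgClosed {F : Type*} [RCLike F] [IsAlgClosed F] (n : ℕ) :
    ∀ (ι : Type u) [Fintype ι] [DecidableEq ι], Fintype.card ι = n + 1 →
      ∀ T : Fin 3 → Matrix ι ι F, SlicesRankLE T (2 * n + 1) := by
  induction n with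
  | zero => exact fun ι _ _ hι T => slicesRankLE_of_card_eq_one hι T
  | succ n ih =>
    intro ι _ _ hι
    have : Nontrivial ι := Fintype.one_lt_card_iff_nontrivial.1 (by omega)
    refine slicesRankLE_of_forall_det_eq_zero
      (fun M => IsAlgClosed.exists_root _ (by
        rw [M.charpoly_degree_eq_dim, hι]
        exact_mod_cast n.succ.succ_ne_zero))
      (slicesRankLE_of_forall_diagonal fun χ B C h01 ⟨z, hz⟩ => ?_)
    rcases slicesRankLE_or_hasThinCross h01 B C with h | h
    · exact h.mono (by omega)
    · exact slicesRankLE_of_hasThinCross hz (h z hz)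
        (ih {i // i ≠ z} (by rw [card_subtype_ne]; omega) _)

theorem exists_isRoot_of_odd_natDegree_of_monic {p : Polynomial ℝ} (hp : p.Monic)
    (hodd : Odd p.natDegree) : ∃ t, p.IsRoot t := by
  have hdeg : 0 < p.degree := Polynomial.natDegree_pos_iff_degree_pos.1 hodd.pos
  have htop : Filter.Tendsto (fun x => p.eval x) Filter.atTop Filter.atTop :=
    p.tendsto_atTop_of_leadingCoeff_nonneg hdeg (by rw [hp.leadingCoeff]; exact zero_le_one)
  -- As the degree is odd, `q` has leading coefficient `1`; its limit at `+∞` gives that of `p` at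
  -- `-∞`.
  set q := -p.comp (-Polynomial.X) with hq
  have hqd : q.natDegree = p.natDegree := by simp [hq, Polynomial.natDegree_comp]
  have hql : q.leadingCoeff = 1 := by
    rw [hq, Polynomial.leadingCoeff_neg, Polynomial.leadingCoeff_comp (by simp)]
    simp [hp.leadingCoeff, hodd.neg_one_pow]
  have hqtop : Filter.Tendsto (fun x => q.eval x) Filter.atTop Filter.atTop :=
    q.tendsto_atTop_of_leadingCoeff_nonneg
      (Polynomial.natDegree_pos_iff_degree_pos.1 (by rw [hqd]; exact hodd.pos))
      (by rw [hql]; exact zero_le_one)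
  have hbot : Filter.Tendsto (fun x => p.eval x) Filter.atBot Filter.atBot := by
    have h := Filter.tendsto_neg_atTop_atBot.comp (hqtop.comp Filter.tendsto_neg_atBot_atTop)
    refine h.congr fun x => ?_
    simp [hq]
  exact p.continuous.surjective htop hbot 0

/-- Over the real numbers, an `n × n × 3` tensor with `n` odd has rank at most `2 n - 1`. -/
theorem slicesRankLE_of_odd (n : ℕ) :
    ∀ (ι : Type u) [Fintype ι] [DecidableEq ι], Fintype.card ι = 2 * n + 1 →
      ∀ T : Fin 3 → Matrix ι ι ℝ, SlicesRankLE T (4 * n + 1) := by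
  induction n with
  | zero => exact fun ι _ _ hι T => slicesRankLE_of_card_eq_one hι T
  | succ n ih =>
    intro ι _ _ hι
    have : Nontrivial ι := Fintype.one_lt_card_iff_nontrivial.1 (by omega)
    refine slicesRankLE_of_forall_det_eq_zero
      (fun M => exists_isRoot_of_odd_natDegree_of_monic M.charpoly_monic
        ⟨n + 1, by rw [M.charpoly_natDegree_eq_dim, hι]⟩)
      (slicesRankLE_of_forall_diagonal fun χ B C h01 ⟨z, hz⟩ => ?_)
    rcases slicesRankLE_or_hasThinCross h01 B C with h | h
    · exact h.mono (by omega)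
    · by_cases hz' : ∃ z', z' ≠ z ∧ χ z' = 0
      · obtain ⟨z', hne, hz'⟩ := hz'
        have hcard := card_subtype_ne z
        have : Nontrivial {i // i ≠ z} := Fintype.one_lt_card_iff_nontrivial.1 (by omega)
        refine slicesRankLE_of_hasThinCross (r := 4 * n + 1 + 2) hz (h z hz) ?_
        refine slicesRankLE_of_hasThinCross (z := ⟨z', hne⟩) hz' ?_
          (ih {i : {i // i ≠ z} // i ≠ ⟨z', hne⟩} (by rw [card_subtype_ne, hcard]; omega) _)
        -- Thinness at `z'` was obtained for the full matrices and passes to submatrices, so the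
        -- intermediate even size needs no dichotomy of its own.
        exact HasThinCross.submatrix (z := (⟨z', hne⟩ : {i // i ≠ z})) Subtype.val (h z' hz')
      · push Not at hz'
        exact (slicesRankLE_of_corank_one hz (fun i hi => (h01 i).resolve_left (hz' i hi))
          (h z hz)).mono (by omega)

theorem isSumOfPure_of_slicesRankLE {F : Type*} [Field F] {m n r : ℕ}
    (h : ∀ T : Fin 3 → Matrix (Fin m) (Fin n) F, SlicesRankLE T r) (x : Tensor3 F m n 3) :
    IsSumOfPure x r := by
  let b := ((Pi.basisFun F (Fin m)).tensorProduct (Pi.basisFun F (Fin n))).tensorProduct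
    (Pi.basisFun F (Fin 3))
  obtain ⟨u, v, w, huvw⟩ := h fun k => Matrix.of fun i j => b.repr x ((i, j), k)
  refine ⟨u, v, w, b.ext_elem fun ⟨⟨i, j⟩, k⟩ => ?_⟩
  have hk : b.repr x ((i, j), k) = _ := congrFun (congrFun (huvw k) i) j
  have hsum := map_sum (b.coord ((i, j), k)) (fun s => (u s ⊗ₜ[F] v s) ⊗ₜ[F] w s) Finset.univ
  simp only [Module.Basis.coord_apply] at hsum
  rw [hk, Matrix.sum_apply, hsum]
  refine Finset.sum_congr rfl fun s _ => ?_
  simp [b, vecMulVec_apply, mul_comm]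

theorem maxRank_le {F : Type*} [Field F] {n r : ℕ}
    (h : ∀ T : Fin 3 → Matrix (Fin n) (Fin n) F, SlicesRankLE T r) : maxRank F n n 3 ≤ r := by
  refine iSup_le fun x => ?_
  exact iInf₂_le r (isSumOfPure_of_slicesRankLE h x)

end Main

theorem mainTheorem6 :
    (maxRank ℝ 3 3 3 ≤ 5 ∧ maxRank ℂ 3 3 3 ≤ 5) ∧
    maxRank ℂ 4 4 3 ≤ 7 ∧
    (maxRank ℝ 5 5 3 ≤ 9 ∧ maxRank ℂ 5 5 3 ≤ 9) ∧
    maxRank ℂ 6 6 3 ≤ 11 :=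
  ⟨⟨maxRank_le (slicesRankLE_of_odd 1 _ (by simp)),
    maxRank_le (slicesRankLE_of_isAlgClosed 2 _ (by simp))⟩,
    maxRank_le (slicesRankLE_of_isAlgClosed 3 _ (by simp)),
    ⟨maxRank_le (slicesRankLE_of_odd 2 _ (by simp)),
      maxRank_le (slicesRankLE_of_isAlgClosed 4 _ (by simp))⟩,
    maxRank_le (slicesRankLE_of_isAlgClosed 5 _ (by simp))⟩
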